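/- Let $\mathcal{M}(2;\mathbb{C})\simeq\mathbb{C}^4$ be the space of complex $2\times 2$ matrices and $\mathcal{D}\simeq\mathbb{C}^2$, $(\lambda_1,\lambda_2)\leftrightarrow\mathrm{diag}(\lambda_1,\lambda_2)$, the plane of diagonal matrices. A rational map between affine spaces is a map whose components are quotients of polynomials; its indeterminacy set $\mathrm{Ind}$ is the union of the polar sets of its components. It is birational if it has a rational inverse. Let $\mathrm{Inv}\colon\mathcal{M}(2;\mathbb{C})\to\mathbb{C}^2$, $M\mapsto(\mathrm{tr}\,M,\det M)$. Let $\Phi\colon\mathcal{M}(2;\mathbb{C})\dashrightarrow\mathcal{M}(2;\mathbb{C})$ be a rational map compatible with conjugation, i.e. $A\,\Phi(M)\,A^{-1}=\Phi(AMA^{-1})$ for all $A\in\mathrm{GL}(2;\mathbb{C})$ and all $M$ such that $M$ and $AMA^{-1}$ are not in $\mathrm{Ind}\,\Phi$. Then: (1) $\mathcal{D}\not\subset\mathrm{Ind}\,\Phi$, $\Phi(\mathcal{D}\setminus\mathrm{Ind}\,\Phi)\subset\mathcal{D}$, and $\Phi$ restricts to a unique rational map $\Phi_{|\mathcal{D}}\colon\mathcal{D}\dashrightarrow\mathcal{D}$,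 which is defined and equal to $\Phi$ at every point of $\mathcal{D}\setminus\mathrm{Ind}\,\Phi$; the map $\Phi$ is birational if and only if $\Phi_{|\mathcal{D}}$ is birational. (2) There is a unique rational map $\mathrm{Sq}\,\Phi\colon\mathbb{C}^2\dashrightarrow\mathbb{C}^2$ such that $\mathrm{Inv}\circ\Phi=\mathrm{Sq}\,\Phi\circ\mathrm{Inv}$ as rational maps; the map $\Phi$ is birational if and only if $\mathrm{Sq}\,\Phi$ is birational. -/

import Mathlib

open scoped MatrixGroups

noncomputable section

/-- The field `ℂ(x_i, i ∈ σ)` of rational functions on the affine space `ℂ^σ`. -/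
abbrev RatFun (σ : Type) : Type := FractionRing (MvPolynomial σ ℂ)

/-- A rational map `ℂ^σ ⇢ ℂ^τ`: its components are quotients of polynomials. -/
abbrev RatMap (σ τ : Type) : Type := τ → RatFun σ

/-- The property `P` holds on a nonempty Zariski open subset of `ℂ^σ` (nonempty principal opens
form a basis of the nonempty opens). -/
def Generically {σ : Type} (P : (σ → ℂ) → Prop) : Prop :=
  ∃ h : MvPolynomial σ ℂ, h ≠ 0 ∧ ∀ p : σ → ℂ, MvPolynomial.eval p h ≠ 0 → P p

namespace RatMap

/-- The indeterminacy set: the union of the polar sets of the components, the polar set of a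
rational function being the zero set of its reduced denominator. -/
def Ind {σ τ : Type} (f : RatMap σ τ) : Set (σ → ℂ) :=
  {p | ∃ i, MvPolynomial.eval p (IsFractionRing.den (MvPolynomial σ ℂ) (f i)
    : MvPolynomial σ ℂ) = 0}

/-- The value of a rational map at a point; only used at points outside `f.Ind`. -/
def value {σ τ : Type} (f : RatMap σ τ) (p : σ → ℂ) : τ → ℂ := fun i =>
  MvPolynomial.eval p (IsFractionRing.num (MvPolynomial σ ℂ) (f i)) /
    MvPolynomial.eval p (IsFractionRing.den (MvPolynomial σ ℂ) (f i) : MvPolynomial σ ℂ)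

/-- The composite `g ∘ f` makes sense and is the identity, as a rational map. -/
def IsLeftInverse {σ τ : Type} (g : RatMap τ σ) (f : RatMap σ τ) : Prop :=
  Generically fun p : σ → ℂ => p ∉ f.Ind ∧ f.value p ∉ g.Ind ∧ g.value (f.value p) = p

/-- A rational map is birational if it has a rational inverse. -/
def IsBirational {σ τ : Type} (f : RatMap σ τ) : Prop :=
  ∃ g : RatMap τ σ, IsLeftInverse g f ∧ IsLeftInverse f g

end RatMap

/-- The matrix entries, as coordinates identifying `M(2;ℂ)` with `ℂ⁴`. -/
def entries (M : Matrix (Fin 2) (Fin 2) ℂ) : Fin 2 × Fin 2 → ℂ := fun ij => M ij.1 ij.2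

/-- A rational map `M(2;ℂ) ⇢ M(2;ℂ)`. -/
abbrev MatRatMap : Type := RatMap (Fin 2 × Fin 2) (Fin 2 × Fin 2)

namespace MatRatMap

/-- `M` is a point of indeterminacy of `Φ`. -/
def Indet (Φ : MatRatMap) (M : Matrix (Fin 2) (Fin 2) ℂ) : Prop := entries M ∈ RatMap.Ind Φ

/-- The value `Φ(M)`, only used when `M` is not a point of indeterminacy. -/
def evalAt (Φ : MatRatMap) (M : Matrix (Fin 2) (Fin 2) ℂ) : Matrix (Fin 2) (Fin 2) ℂ :=
  Matrix.of fun i j => RatMap.value Φ (entries M) (i, j)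

/-- `A Φ(M) A⁻¹ = Φ(A M A⁻¹)` whenever `M` and `A M A⁻¹` lie outside `Ind Φ`. -/
def ConjCompatible (Φ : MatRatMap) : Prop :=
  ∀ (A : GL (Fin 2) ℂ) (M : Matrix (Fin 2) (Fin 2) ℂ),
    ¬ Φ.Indet M → ¬ Φ.Indet (A.val * M * A⁻¹.val) →
      A.val * Φ.evalAt M * A⁻¹.val = Φ.evalAt (A.val * M * A⁻¹.val)

/-- `Ψ` is the restriction `Φ|_D : D ⇢ D` of `Φ` to the plane `D` of diagonal matrices, where
`D` is identified with `ℂ²` through `(l₁, l₂) ↦ diag(l₁, l₂)`: `D` is not contained in `Ind Φ`,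
and `Ψ` is defined and agrees with `Φ` at every point of `D` outside `Ind Φ`. -/
def IsDiagRestriction (Φ : MatRatMap) (Ψ : RatMap (Fin 2) (Fin 2)) : Prop :=
  (∃ l : Fin 2 → ℂ, ¬ Φ.Indet (Matrix.diagonal l)) ∧
    ∀ l : Fin 2 → ℂ, ¬ Φ.Indet (Matrix.diagonal l) →
      l ∉ Ψ.Ind ∧ Φ.evalAt (Matrix.diagonal l) = Matrix.diagonal (Ψ.value l)

end MatRatMap

/-- The similarity invariants `Inv M = (tr M, det M)`. -/
def simInv (M : Matrix (Fin 2) (Fin 2) ℂ) : Fin 2 → ℂ := ![M.trace, M.det]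

/-- `W` is the skeleton `Sq Φ`: the equality of rational maps `W ∘ Inv = Inv ∘ Φ` holds (both
sides being defined and equal on a nonempty Zariski open set of matrices). -/
def MatRatMap.IsSkeleton (Φ : MatRatMap) (W : RatMap (Fin 2) (Fin 2)) : Prop :=
  Generically fun p : Fin 2 × Fin 2 → ℂ =>
    let M : Matrix (Fin 2) (Fin 2) ℂ := Matrix.of fun i j => p (i, j)
    ¬ Φ.Indet M ∧ simInv M ∉ W.Ind ∧ W.value (simInv M) = simInv (Φ.evalAt M)

end

open scoped MatrixGroups

noncomputable section

open MvPolynomial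

/-! ### Generic properties and regular functions -/

section Calculus

variable {σ τ : Type}

/-! Compatibility makes `Ind Φ` invariant under conjugation: `M ↦ A⁻¹ Φ(A M A⁻¹) A` is generically
equal to `Φ`, so `Φ` is defined wherever this map is regular (`regularAt_eq_value`). A generic
matrix is conjugate both to `diag(l)`, with `l` its eigenvalues, and to the companion matrix `C_s`
of its invariants `s`, so `Φ` is determined by its values on these two slices. Moreover `Φ(M)`
commutes with the centralizer of `M` in `GL₂`; hence `Φ` preserves the diagonal plane, and
generically `Φ(C_s) = a(s) + b(s) C_s`. The skeleton is `s ↦ Inv Φ(C_s)`.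

A rational inverse of `Φ` is again compatible (`of_isLeftInverse`), so its restriction and skeleton
invert those of `Φ`.

Conversely, an inverse of the restriction commutes with the swap of `l₀, l₁`. Its first component is
`(α + β l₀)/δ` with symmetric `α, β, δ`, and the swap gives the second, so `M ↦ (α + β M)/δ`, with
coefficients evaluated at `Inv M`, extends it to matrices and inverts `Φ` (`exists_diagModel`). If
instead the skeleton `W` has inverse `W'`, then `b` is generically nonzero, as otherwise the image
of `W` would lie in the discriminant curve; `N = a(s) + b(s) M` is then solved for `M` with `s =
W'(Inv N)`. -/

theorem Generically.mono {P Q : (σ → ℂ) → Prop} (hP : Generically P) (h : ∀ p, P p → Q p) :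
    Generically Q := by
  obtain ⟨k, hk, hkP⟩ := hP
  exact ⟨k, hk, fun p hp => h p (hkP p hp)⟩

theorem Generically.and {P Q : (σ → ℂ) → Prop} (hP : Generically P) (hQ : Generically Q) :
    Generically fun p => P p ∧ Q p := by
  obtain ⟨k, hk, hkP⟩ := hP
  obtain ⟨l, hl, hlQ⟩ := hQ
  refine ⟨k * l, mul_ne_zero hk hl, fun p hp => ?_⟩
  rw [map_mul] at hp
  exact ⟨hkP p (left_ne_zero_of_mul hp), hlQ p (right_ne_zero_of_mul hp)⟩

theorem MvPolynomial.exists_eval_ne_zero {h : MvPolynomial σ ℂ} (hh : h ≠ 0) :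
    ∃ p, eval p h ≠ 0 := by
  by_contra! H
  exact hh (MvPolynomial.funext fun p => by simpa using H p)

theorem Generically.exists {P : (σ → ℂ) → Prop} (hP : Generically P) : ∃ p, P p := by
  obtain ⟨k, hk, hkP⟩ := hP
  obtain ⟨p, hp⟩ := exists_eval_ne_zero hk
  exact ⟨p, hkP p hp⟩

theorem Generically.forall_finite {ι : Type} [Finite ι] {P : ι → (σ → ℂ) → Prop}
    (hP : ∀ i, Generically (P i)) : Generically fun p => ∀ i, P i p := by
  have := Fintype.ofFinite ι
  choose h hh hP using hP
  refine ⟨∏ i, h i, Finset.prod_ne_zero_iff.2 fun i _ => hh i, fun p hp i => hP i p ?_⟩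
  rw [map_prod] at hp
  exact Finset.prod_ne_zero_iff.1 hp i (Finset.mem_univ i)

/-- `F` is a quotient of polynomials on a Zariski neighbourhood of `p`. -/
def RegularAt (F : (σ → ℂ) → ℂ) (p : σ → ℂ) : Prop :=
  ∃ n d : MvPolynomial σ ℂ, eval p d ≠ 0 ∧ ∀ q, eval q d ≠ 0 → F q = eval q n / eval q d

namespace RegularAt

variable {F G K : (σ → ℂ) → ℂ} {p : σ → ℂ}

theorem eval (n : MvPolynomial σ ℂ) (p : σ → ℂ) : RegularAt (fun q => MvPolynomial.eval q n) p :=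
  ⟨n, 1, by simp, by simp⟩

theorem const (c : ℂ) (p : σ → ℂ) : RegularAt (fun _ => c) p := by
  simpa using eval (C c) p

theorem coord (i : σ) (p : σ → ℂ) : RegularAt (fun q => q i) p := by
  simpa using eval (X i) p

theorem add (hF : RegularAt F p) (hG : RegularAt G p) : RegularAt (fun q => F q + G q) p := by
  obtain ⟨n, d, hd, hF⟩ := hF
  obtain ⟨m, e, he, hG⟩ := hG
  refine ⟨n * e + d * m, d * e, by simp [hd, he], fun q hq => ?_⟩
  rw [map_mul] at hq
  have h1 := left_ne_zero_of_mul hq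
  have h2 := right_ne_zero_of_mul hq
  beta_reduce
  rw [hF q h1, hG q h2, div_add_div _ _ h1 h2]
  simp

theorem mul (hF : RegularAt F p) (hG : RegularAt G p) : RegularAt (fun q => F q * G q) p := by
  obtain ⟨n, d, hd, hF⟩ := hF
  obtain ⟨m, e, he, hG⟩ := hG
  refine ⟨n * m, d * e, by simp [hd, he], fun q hq => ?_⟩
  rw [map_mul] at hq
  beta_reduce
  rw [hF q (left_ne_zero_of_mul hq), hG q (right_ne_zero_of_mul hq), div_mul_div_comm]
  simp

theorem neg (hF : RegularAt F p) : RegularAt (fun q => -F q) p := by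
  simpa using (const (-1) p).mul hF

theorem sub (hF : RegularAt F p) (hG : RegularAt G p) : RegularAt (fun q => F q - G q) p := by
  simpa [sub_eq_add_neg] using hF.add hG.neg

/-- The factor `K` shrinks the neighbourhood: agreement with `F` is only needed off its zeros, for
instance where a denominator does not vanish. -/
theorem congr (hF : RegularAt F p) (hK : RegularAt K p) (hKp : K p ≠ 0)
    (h : ∀ q, K q ≠ 0 → G q = F q) : RegularAt G p := by
  obtain ⟨n, d, hd, hF⟩ := hF
  obtain ⟨m, e, he, hK⟩ := hK
  have hm : MvPolynomial.eval p m ≠ 0 := fun h0 => hKp (by rw [hK p he, h0, zero_div])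
  refine ⟨n * (m * e), d * (m * e), by simp [hd, he, hm], fun q hq => ?_⟩
  simp only [map_mul] at hq ⊢
  have h1 := left_ne_zero_of_mul hq
  have h2 := right_ne_zero_of_mul hq
  have hKq : K q ≠ 0 := by
    rw [hK q (right_ne_zero_of_mul h2)]
    exact div_ne_zero (left_ne_zero_of_mul h2) (right_ne_zero_of_mul h2)
  rw [h q hKq, hF q h1, mul_div_mul_right _ _ h2]

theorem inv (hF : RegularAt F p) (hp : F p ≠ 0) : RegularAt (fun q => (F q)⁻¹) p := by
  obtain ⟨n, d, hd, hF⟩ := hF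
  have hn : MvPolynomial.eval p n ≠ 0 := fun h0 => hp (by rw [hF p hd, h0, zero_div])
  refine ⟨d * d, n * d, by simp [hd, hn], fun q hq => ?_⟩
  rw [map_mul] at hq
  have h2 := right_ne_zero_of_mul hq
  beta_reduce
  rw [hF q h2, inv_div, map_mul, map_mul, mul_div_mul_right _ _ h2]

theorem div (hF : RegularAt F p) (hG : RegularAt G p) (hp : G p ≠ 0) :
    RegularAt (fun q => F q / G q) p := by
  simpa [div_eq_mul_inv] using hF.mul (hG.inv hp)

theorem eval_comp {T : (σ → ℂ) → τ → ℂ} (n : MvPolynomial τ ℂ)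
    (hT : ∀ i, RegularAt (fun q => T q i) p) :
    RegularAt (fun q => MvPolynomial.eval (T q) n) p := by
  induction n using MvPolynomial.induction_on with
  | C c => simpa using const c p
  | add a b ha hb => simpa using ha.add hb
  | mul_X a i ha => simpa using ha.mul (hT i)

theorem comp {H : (τ → ℂ) → ℂ} {T : (σ → ℂ) → τ → ℂ} (hH : RegularAt H (T p))
    (hT : ∀ i, RegularAt (fun q => T q i) p) : RegularAt (fun q => H (T q)) p := by
  obtain ⟨n, d, hd, hH⟩ := hH
  exact ((eval_comp n hT).div (eval_comp d hT) hd).congr (eval_comp d hT) hd fun q hq => hH _ hq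

theorem generically_ne_zero (hF : RegularAt F p) (hp : F p ≠ 0) :
    Generically fun q => F q ≠ 0 := by
  obtain ⟨n, d, hd, hF⟩ := hF
  have hn : MvPolynomial.eval p n ≠ 0 := fun h0 => hp (by rw [hF p hd, h0, zero_div])
  refine ⟨n * d, fun h0 => mul_ne_zero hn hd (by rw [← map_mul, h0, map_zero]), fun q hq => ?_⟩
  rw [map_mul] at hq
  rw [hF q (right_ne_zero_of_mul hq)]
  exact div_ne_zero (left_ne_zero_of_mul hq) (right_ne_zero_of_mul hq)

theorem eq_of_generically (hF : RegularAt F p) (hG : RegularAt G p)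
    (h : Generically fun q => F q = G q) : F p = G p := by
  by_contra hne
  obtain ⟨q, h1, h2⟩ := (h.and ((hF.sub hG).generically_ne_zero (sub_ne_zero.2 hne))).exists
  exact h2 (sub_eq_zero.2 h1)

/-- Irreducibility of affine space: one nonzero value at a regular point spreads to an open set;
otherwise `F` vanishes wherever its denominator at `p` does not. With a dominant map this refutes
generic failure of an identity known only after composition. -/
theorem generically_eq_zero_or_ne_zero (hF : RegularAt F p) :
    (Generically fun q => F q = 0) ∨ Generically fun q => F q ≠ 0 := by
  by_cases h : ∃ q, RegularAt F q ∧ F q ≠ 0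
  · obtain ⟨q, hq, hq0⟩ := h
    exact Or.inr (hq.generically_ne_zero hq0)
  · push Not at h
    obtain ⟨n, d, hd, hF⟩ := hF
    exact Or.inl ⟨d, fun h0 => hd (by simp [h0]), fun q hq => h q ⟨n, d, hq, hF⟩⟩

end RegularAt

theorem Generically.comp_of_regularAt {P : (τ → ℂ) → Prop} {h : MvPolynomial τ ℂ}
    (hP : ∀ q, MvPolynomial.eval q h ≠ 0 → P q) {T : (σ → ℂ) → τ → ℂ} {p : σ → ℂ}
    (hT : ∀ i, RegularAt (fun q => T q i) p) (hp : MvPolynomial.eval (T p) h ≠ 0) :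
    Generically fun q => P (T q) :=
  ((RegularAt.eval_comp h hT).generically_ne_zero hp).mono fun _ => hP _

/-- The preimages under `T` of nonempty open sets contain nonempty open sets. -/
def Dominant (T : (σ → ℂ) → τ → ℂ) : Prop :=
  ∀ P : (τ → ℂ) → Prop, Generically P → Generically fun q => P (T q)

theorem Dominant.of_surjective {T : (σ → ℂ) → τ → ℂ} (hT : ∀ p i, RegularAt (fun q => T q i) p)
    (hs : Function.Surjective T) : Dominant T := by
  rintro P ⟨h, hh, hP⟩
  obtain ⟨y, hy⟩ := exists_eval_ne_zero hh
  obtain ⟨p, rfl⟩ := hs y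
  exact .comp_of_regularAt hP (hT p) hy

/-! ### Rational functions and rational maps -/

/-- Since numerator and reduced denominator are coprime, the polar set is contained in the zero set
of the denominator of any presentation. -/
theorem RatFun.den_dvd {f : RatFun σ} {n d : MvPolynomial σ ℂ} (hd : d ≠ 0)
    (h : f = algebraMap _ (RatFun σ) n / algebraMap _ (RatFun σ) d) :
    (IsFractionRing.den (MvPolynomial σ ℂ) f : MvPolynomial σ ℂ) ∣ d ∧
    IsFractionRing.num (MvPolynomial σ ℂ) f * d =
      n * (IsFractionRing.den (MvPolynomial σ ℂ) f : MvPolynomial σ ℂ) := by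
  have hinj := IsFractionRing.injective (MvPolynomial σ ℂ) (RatFun σ)
  have hd' : algebraMap _ (RatFun σ) d ≠ 0 := by simpa using hd
  have hden : algebraMap _ (RatFun σ)
      (IsFractionRing.den (MvPolynomial σ ℂ) f : MvPolynomial σ ℂ) ≠ 0 := by
    simp [nonZeroDivisors.coe_ne_zero (IsFractionRing.den (MvPolynomial σ ℂ) f)]
  have h2 : IsFractionRing.num (MvPolynomial σ ℂ) f * d =
      n * (IsFractionRing.den (MvPolynomial σ ℂ) f : MvPolynomial σ ℂ) := by
    apply hinj
    have h3 := IsFractionRing.mk'_num_den (MvPolynomial σ ℂ) f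
    rw [IsFractionRing.mk'_eq_div] at h3
    rw [map_mul, map_mul, ← div_eq_div_iff hden hd', h3, h]
  refine ⟨?_, h2⟩
  exact (IsFractionRing.num_den_reduced (MvPolynomial σ ℂ) f).symm.dvd_of_dvd_mul_left
    (h2 ▸ Dvd.intro_left n rfl)

namespace RatMap

theorem regularAt_value {f : RatMap σ τ} {p : σ → ℂ} (hp : p ∉ f.Ind) (i : τ) :
    RegularAt (fun q => f.value q i) p := by
  refine ⟨_, IsFractionRing.den (MvPolynomial σ ℂ) (f i), fun h => hp ⟨i, h⟩, fun q _ => rfl⟩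

theorem generically_not_mem_ind [Finite τ] (f : RatMap σ τ) : Generically fun p => p ∉ f.Ind := by
  have : Generically fun p => ∀ i, MvPolynomial.eval p
      (IsFractionRing.den (MvPolynomial σ ℂ) (f i) : MvPolynomial σ ℂ) ≠ 0 :=
    .forall_finite fun i => ⟨_, nonZeroDivisors.coe_ne_zero _, fun _ h => h⟩
  exact this.mono fun p hp ⟨i, hi⟩ => hp i hi

theorem ext_of_generically {f g : RatMap σ τ} (h : Generically fun p => f.value p = g.value p) :
    f = g := by
  funext i
  rw [← IsFractionRing.mk'_num_den (MvPolynomial σ ℂ) (f i),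
    ← IsFractionRing.mk'_num_den (MvPolynomial σ ℂ) (g i), IsLocalization.mk'_eq_iff_eq]
  congr 1
  obtain ⟨k, hk, h⟩ := h
  set a := IsFractionRing.num (MvPolynomial σ ℂ) (f i)
  set b := IsFractionRing.den (MvPolynomial σ ℂ) (f i)
  set c := IsFractionRing.num (MvPolynomial σ ℂ) (g i)
  set d := IsFractionRing.den (MvPolynomial σ ℂ) (g i)
  by_contra hne
  have := mul_ne_zero (mul_ne_zero hk (sub_ne_zero.2 hne))
    (mul_ne_zero (nonZeroDivisors.coe_ne_zero b) (nonZeroDivisors.coe_ne_zero d))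
  obtain ⟨p, hp⟩ := exists_eval_ne_zero this
  simp only [map_mul, map_sub, mul_ne_zero_iff] at hp
  obtain ⟨⟨h1, h2⟩, h3, h4⟩ := hp
  have h5 := congrFun (h p h1) i
  change MvPolynomial.eval p a / MvPolynomial.eval p (b : MvPolynomial σ ℂ) =
    MvPolynomial.eval p c / MvPolynomial.eval p (d : MvPolynomial σ ℂ) at h5
  rw [div_eq_div_iff h3 h4] at h5
  apply h2
  linear_combination h5

/-- A map that is regular at some point is represented by a rational map, which is defined
wherever the map is regular. -/
theorem exists_of_regularAt {T : (σ → ℂ) → τ → ℂ} {p : σ → ℂ}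
    (hT : ∀ i, RegularAt (fun q => T q i) p) : ∃ f : RatMap σ τ,
      ∀ q, (∀ i, RegularAt (fun q => T q i) q) → q ∉ f.Ind ∧ f.value q = T q := by
  choose n d hd hT using hT
  have hd0 : ∀ i, d i ≠ 0 := fun i h => hd i (by simp [h])
  -- Local presentations at different points give the same element of the function field, so a
  -- single choice serves everywhere.
  have key : ∀ i (m e : MvPolynomial σ ℂ) (q : σ → ℂ), MvPolynomial.eval q e ≠ 0 →
      (∀ q, MvPolynomial.eval q e ≠ 0 →
        T q i = MvPolynomial.eval q m / MvPolynomial.eval q e) →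
      algebraMap _ (RatFun σ) (n i) / algebraMap _ (RatFun σ) (d i) =
        algebraMap _ (RatFun σ) m / algebraMap _ (RatFun σ) e := by
    intro i m e q hq he
    have he0 : e ≠ 0 := fun h => hq (by simp [h])
    rw [div_eq_div_iff (by simpa using hd0 i) (by simpa using he0), ← map_mul, ← map_mul]
    congr 1
    by_contra hne
    obtain ⟨x, hx⟩ := exists_eval_ne_zero
      (mul_ne_zero (sub_ne_zero.2 hne) (mul_ne_zero (hd0 i) he0))
    simp only [map_mul, map_sub, mul_ne_zero_iff] at hx
    obtain ⟨h2, h3, h4⟩ := hx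
    have h5 : T x i = _ := hT i x h3
    rw [he x h4, div_eq_div_iff h4 h3] at h5
    apply h2
    linear_combination -h5
  refine ⟨fun i => algebraMap _ (RatFun σ) (n i) / algebraMap _ (RatFun σ) (d i), fun q hq => ?_⟩
  choose m e he hq using hq
  have hdvd := fun i => RatFun.den_dvd (fun h => he i (by simp [h])) (key i _ _ q (he i) (hq i))
  have hden : ∀ i, MvPolynomial.eval q (IsFractionRing.den (MvPolynomial σ ℂ)
      (algebraMap _ (RatFun σ) (n i) / algebraMap _ (RatFun σ) (d i)) : MvPolynomial σ ℂ) ≠ 0 := by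
    intro i h0
    have h1 := map_dvd (MvPolynomial.eval q) (hdvd i).1
    rw [h0] at h1
    exact he i (zero_dvd_iff.1 h1)
  refine ⟨fun ⟨i, hi⟩ => hden i hi, funext fun i => ?_⟩
  refine Eq.trans ?_ (hq i q (he i)).symm
  refine (div_eq_div_iff (hden i) (he i)).2 ?_
  rw [← map_mul, ← map_mul, (hdvd i).2]

/-- Removal of poles: the rational map built from `T` equals `f` in the function field, hence shares
its reduced denominators. -/
theorem regularAt_eq_value {f : RatMap σ τ} {T : (σ → ℂ) → τ → ℂ} {p : σ → ℂ} [Finite τ]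
    (hT : ∀ i, RegularAt (fun q => T q i) p)
    (h : Generically fun q => f.value q = T q) : p ∉ f.Ind ∧ f.value p = T p := by
  obtain ⟨g, hg⟩ := exists_of_regularAt hT
  have hTn : Generically fun q => ∀ i, RegularAt (fun q => T q i) q := by
    refine .forall_finite fun i => ?_
    obtain ⟨n, d, hd, hT⟩ := hT i
    exact ⟨d, fun h => hd (by simp [h]), fun q hq => ⟨n, d, hq, hT⟩⟩
  have : f = g := ext_of_generically ((h.and hTn).mono fun q hq => hq.1.trans (hg q hq.2).2.symm)
  exact this ▸ hg p hT

/-- A rational map with a rational section is dominant. -/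
theorem IsLeftInverse.dominant {f : RatMap σ τ} {g : RatMap τ σ}
    (h : IsLeftInverse g f) : Dominant g.value := by
  rintro P ⟨k, hk, hP⟩
  obtain ⟨l, hl, h⟩ := h
  obtain ⟨p, hp⟩ := exists_eval_ne_zero (mul_ne_zero hl hk)
  rw [map_mul] at hp
  obtain ⟨-, hpg, hgp⟩ := h p (left_ne_zero_of_mul hp)
  exact .comp_of_regularAt hP (regularAt_value hpg) (hgp.symm ▸ right_ne_zero_of_mul hp)

end RatMap

end Calculus

/-! ### Similarity classes of `2 × 2` matrices -/

/-- The matrix with given entries. -/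
def ofEntries (p : Fin 2 × Fin 2 → ℂ) : Matrix (Fin 2) (Fin 2) ℂ := Matrix.of fun i j => p (i, j)

/-- The elementary symmetric functions of two numbers. -/
def esymPair (l : Fin 2 → ℂ) : Fin 2 → ℂ := ![l 0 + l 1, l 0 * l 1]

/-- The companion matrix of `x² - s₀ x + s₁`. -/
def companionPair (s : Fin 2 → ℂ) : Matrix (Fin 2) (Fin 2) ℂ := !![0, -s 1; 1, s 0]

theorem simInv_diagonal (l : Fin 2 → ℂ) : simInv (Matrix.diagonal l) = esymPair l := by
  simp [simInv, esymPair]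

theorem simInv_companionPair (s : Fin 2 → ℂ) : simInv (companionPair s) = s := by
  ext i
  fin_cases i <;> simp [simInv, companionPair, Matrix.trace_fin_two, Matrix.det_fin_two]

theorem simInv_conj (A : GL (Fin 2) ℂ) (M : Matrix (Fin 2) (Fin 2) ℂ) :
    simInv (A.val * M * A⁻¹.val) = simInv M := by
  have h1 : (A.val * M * A⁻¹.val).trace = M.trace := by
    rw [Matrix.trace_mul_comm, ← mul_assoc, Units.inv_mul, one_mul]
  have h2 : (A.val * M * A⁻¹.val).det = M.det := by
    rw [Matrix.det_mul, Matrix.det_mul, mul_right_comm, ← Matrix.det_mul, Units.mul_inv,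
      Matrix.det_one, one_mul]
  rw [simInv, h1, h2, simInv]

theorem esymPair_comp_swap (l : Fin 2 → ℂ) : esymPair (l ∘ Equiv.swap 0 1) = esymPair l := by
  simp [esymPair, add_comm, mul_comm]

theorem esymPair_surjective : Function.Surjective esymPair := by
  intro s
  obtain ⟨r, hr⟩ := IsAlgClosed.exists_pow_nat_eq (s 0 ^ 2 - 4 * s 1) (n := 2) two_pos
  refine ⟨![(s 0 + r) / 2, (s 0 - r) / 2], ?_⟩
  ext i
  fin_cases i
  · simp [esymPair]; ring
  · simp [esymPair]; linear_combination -hr / 4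

theorem conj_eq_of_mul_eq {A : GL (Fin 2) ℂ} {M N : Matrix (Fin 2) (Fin 2) ℂ}
    (h : M * A.val = A.val * N) : M = A.val * N * A⁻¹.val := by
  rw [← h, mul_assoc, Units.mul_inv, mul_one]

theorem exists_conj_diagonal {M : Matrix (Fin 2) (Fin 2) ℂ} (hM : M 1 0 ≠ 0) {l : Fin 2 → ℂ}
    (hl : l 0 ≠ l 1) (h : esymPair l = simInv M) :
    ∃ A : GL (Fin 2) ℂ, M = A.val * Matrix.diagonal l * A⁻¹.val := by
  have h0 : l 0 + l 1 = M 0 0 + M 1 1 := by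
    simpa [esymPair, simInv, Matrix.trace_fin_two] using congrFun h 0
  have h1 : l 0 * l 1 = M 0 0 * M 1 1 - M 0 1 * M 1 0 := by
    simpa [esymPair, simInv, Matrix.det_fin_two] using congrFun h 1
  -- The columns are eigenvectors of `M` for `l 0` and `l 1`; the determinant is `(l 0 - l 1) * M 1
  -- 0`.
  refine ⟨Matrix.GeneralLinearGroup.mkOfDetNeZero
    !![l 0 - M 1 1, l 1 - M 1 1; M 1 0, M 1 0] ?_, conj_eq_of_mul_eq ?_⟩
  · rw [Matrix.det_fin_two_of, ← sub_mul]
    exact mul_ne_zero (by simpa using sub_ne_zero.2 hl) hM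
  · ext i j
    fin_cases i <;> fin_cases j <;>
      simp [Matrix.GeneralLinearGroup.mkOfDetNeZero, Matrix.mul_apply, Fin.sum_univ_two]
    · linear_combination h1 - l 0 * h0
    · linear_combination h1 - l 1 * h0
    · ring
    · ring

theorem exists_conj_companionPair {M : Matrix (Fin 2) (Fin 2) ℂ} (hM : M 1 0 ≠ 0) :
    ∃ A : GL (Fin 2) ℂ, M = A.val * companionPair (simInv M) * A⁻¹.val := by
  -- The columns are `e₀` and `M e₀`, a cyclic basis when `M 1 0 ≠ 0`.
  refine ⟨Matrix.GeneralLinearGroup.mkOfDetNeZero !![1, M 0 0; 0, M 1 0] ?_,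
    conj_eq_of_mul_eq ?_⟩
  · simpa [Matrix.det_fin_two_of] using hM
  · ext i j
    fin_cases i <;> fin_cases j <;>
      simp [Matrix.GeneralLinearGroup.mkOfDetNeZero, Matrix.mul_apply, Fin.sum_univ_two,
        companionPair, simInv, Matrix.det_fin_two, Matrix.trace_fin_two] <;> ring

/-! ### Regularity of matrix-valued maps -/

section Regular

variable {σ : Type} {M N : (σ → ℂ) → Matrix (Fin 2) (Fin 2) ℂ} {p : σ → ℂ}

theorem RegularAt.matrix_mul (hM : ∀ i j, RegularAt (fun q => M q i j) p)
    (hN : ∀ i j, RegularAt (fun q => N q i j) p) (i j : Fin 2) :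
    RegularAt (fun q => (M q * N q) i j) p := by
  simpa [Matrix.mul_apply, Fin.sum_univ_two] using
    ((hM i 0).mul (hN 0 j)).add ((hM i 1).mul (hN 1 j))

theorem RegularAt.conj (hM : ∀ i j, RegularAt (fun q => M q i j) p) (A B : Matrix (Fin 2) (Fin 2) ℂ)
    (i j : Fin 2) : RegularAt (fun q => (A * M q * B) i j) p :=
  .matrix_mul (.matrix_mul (fun i j => .const (A i j) p) hM) (fun i j => .const (B i j) p) i j

theorem RegularAt.simInv (hM : ∀ i j, RegularAt (fun q => M q i j) p) (i : Fin 2) :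
    RegularAt (fun q => simInv (M q) i) p := by
  fin_cases i
  · simpa [_root_.simInv, Matrix.trace_fin_two] using (hM 0 0).add (hM 1 1)
  · simpa [_root_.simInv, Matrix.det_fin_two] using
      ((hM 0 0).mul (hM 1 1)).sub ((hM 0 1).mul (hM 1 0))

theorem RegularAt.evalAt {Φ : MatRatMap} (hp : ¬ Φ.Indet (M p))
    (hM : ∀ i j, RegularAt (fun q => M q i j) p) (i j : Fin 2) :
    RegularAt (fun q => Φ.evalAt (M q) i j) p :=
  .comp (T := fun q => entries (M q)) (RatMap.regularAt_value hp (i, j)) fun ij => hM ij.1 ij.2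

theorem RegularAt.value_comp {τ υ : Type} {f : RatMap τ υ} {T : (σ → ℂ) → τ → ℂ}
    (hp : T p ∉ f.Ind) (hT : ∀ i, RegularAt (fun q => T q i) p) (i : υ) :
    RegularAt (fun q => f.value (T q) i) p :=
  .comp (RatMap.regularAt_value hp i) hT

theorem RegularAt.ofEntries (p : Fin 2 × Fin 2 → ℂ) (i j : Fin 2) :
    RegularAt (fun q => _root_.ofEntries q i j) p := .coord (i, j) p

theorem RegularAt.diagonal (l : Fin 2 → ℂ) (i j : Fin 2) :
    RegularAt (fun q : Fin 2 → ℂ => Matrix.diagonal q i j) l := by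
  fin_cases i <;> fin_cases j <;> simp [RegularAt.coord, RegularAt.const]

theorem RegularAt.companionPair (s : Fin 2 → ℂ) (i j : Fin 2) :
    RegularAt (fun q => _root_.companionPair q i j) s := by
  fin_cases i <;> fin_cases j <;>
    simp [_root_.companionPair, RegularAt.coord, RegularAt.const, RegularAt.neg]

theorem RegularAt.esymPair (l : Fin 2 → ℂ) (i : Fin 2) :
    RegularAt (fun q => _root_.esymPair q i) l := by
  simpa only [simInv_diagonal] using RegularAt.simInv (RegularAt.diagonal l) i

end Regular

/-! ### Generic matrices, generic eigenvalues, generic invariants -/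

theorem dominant_conj (A : GL (Fin 2) ℂ) :
    Dominant fun p => entries (A.val * ofEntries p * A⁻¹.val) := by
  refine .of_surjective (fun p i => .conj (.ofEntries p) _ _ i.1 i.2) fun p =>
    ⟨entries (A⁻¹.val * ofEntries p * A.val), ?_⟩
  change entries (A.val * (A⁻¹.val * ofEntries p * A.val) * A⁻¹.val) = p
  rw [mul_assoc A⁻¹.val, ← mul_assoc A.val, Units.mul_inv, one_mul, mul_assoc, Units.mul_inv,
    mul_one]
  rfl

theorem dominant_simInv : Dominant fun p => simInv (ofEntries p) :=
  .of_surjective (fun p => .simInv (.ofEntries p)) fun s =>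
    ⟨entries (companionPair s), simInv_companionPair s⟩

theorem dominant_esymPair : Dominant esymPair :=
  .of_surjective RegularAt.esymPair esymPair_surjective

theorem dominant_comp_swap : Dominant fun l : Fin 2 → ℂ => l ∘ Equiv.swap 0 1 :=
  .of_surjective (fun p i => .coord _ p) fun l => ⟨l ∘ Equiv.swap 0 1, by ext i; simp⟩

theorem generically_entry_ne_zero :
    Generically fun p => ofEntries p 1 0 ≠ 0 :=
  (RegularAt.coord (1, 0) fun _ => (1 : ℂ)).generically_ne_zero one_ne_zero

theorem generically_discr_ne_zero :
    Generically fun s : Fin 2 → ℂ => s 0 * s 0 - 4 * s 1 ≠ 0 :=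
  (((RegularAt.coord 0 ![1, 0]).mul (.coord 0 _)).sub
    ((RegularAt.const 4 _).mul (.coord 1 _))).generically_ne_zero (by simp)

theorem esymPair_discr (l : Fin 2 → ℂ) :
    esymPair l 0 * esymPair l 0 - 4 * esymPair l 1 = (l 0 - l 1) ^ 2 := by
  simp [esymPair]; ring

/-- `ℂ[l₀, l₁]` is generated by `1` and `l₀` as a module over the symmetric polynomials. -/
theorem exists_eval_eq_esymPair (h : MvPolynomial (Fin 2) ℂ) : ∃ α β : MvPolynomial (Fin 2) ℂ,
    ∀ l, eval l h = eval (esymPair l) α + eval (esymPair l) β * l 0 := by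
  induction h using MvPolynomial.induction_on with
  | C c => exact ⟨C c, 0, by simp⟩
  | add a b ha hb =>
    obtain ⟨α, β, h⟩ := ha
    obtain ⟨α', β', h'⟩ := hb
    refine ⟨α + α', β + β', fun l => ?_⟩
    simp only [map_add, h, h']
    ring
  | mul_X a i ha =>
    obtain ⟨α, β, h⟩ := ha
    -- With `s = esymPair l`, use `l₀² = s₀ l₀ - s₁` in the first case, `l₁ = s₀ - l₀` and `l₀ l₁ =
    -- s₁` in the second.
    fin_cases i
    · refine ⟨-(β * X 1), α + β * X 0, fun l => ?_⟩
      simp [h, esymPair]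
      ring
    · refine ⟨X 0 * α + β * X 1, -α, fun l => ?_⟩
      simp [h, esymPair]
      ring

theorem Generically.forall_esymPair {P : (Fin 2 → ℂ) → Prop} (hP : Generically P) :
    Generically fun s => ∀ l, esymPair l = s → P l := by
  obtain ⟨h, hh, hP⟩ := hP
  have hn : Generically fun l => eval l h ≠ 0 := ⟨h, hh, fun _ h => h⟩
  obtain ⟨l, hl, hl'⟩ := (hn.and (dominant_comp_swap _ hn)).exists
  obtain ⟨α, β, hαβ⟩ := exists_eval_eq_esymPair h
  -- This is the norm of `h = α + β l₀` over the symmetric polynomials; where it is nonzero, `h` is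
  -- nonzero at both orderings of the roots.
  have key : ∀ l : Fin 2 → ℂ, eval (esymPair l) (α * α + α * β * X 0 + β * β * X 1) =
      eval l h * eval (l ∘ Equiv.swap 0 1) h := by
    intro l
    rw [hαβ l, hαβ (l ∘ _), esymPair_comp_swap]
    simp [esymPair]
    ring
  refine ⟨α * α + α * β * X 0 + β * β * X 1, fun h0 => mul_ne_zero hl hl' ?_, ?_⟩
  · rw [← key, h0, map_zero]
  · rintro s hs l rfl
    rw [key] at hs
    exact hP l (left_ne_zero_of_mul hs)

/-- A rational function of `l₀, l₁` is of the form `(α + β l₀) / δ` with symmetric `α, β, δ`. -/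
theorem exists_eq_div_esymPair {g : (Fin 2 → ℂ) → ℂ} {l : Fin 2 → ℂ} (hg : RegularAt g l) :
    ∃ α β δ : MvPolynomial (Fin 2) ℂ, δ ≠ 0 ∧ ∀ l, eval (esymPair l) δ ≠ 0 →
      g l = (eval (esymPair l) α + eval (esymPair l) β * l 0) / eval (esymPair l) δ := by
  obtain ⟨n, d, hd, hg⟩ := hg
  have hn : Generically fun l => eval l d ≠ 0 := ⟨d, fun h => hd (by simp [h]), fun _ h => h⟩
  obtain ⟨x, hx, hx'⟩ := (hn.and (dominant_comp_swap _ hn)).exists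
  obtain ⟨a, b, hab⟩ := exists_eval_eq_esymPair d
  -- Multiplying the fraction by the swapped denominator turns its denominator into a norm.
  obtain ⟨α, β, hαβ⟩ := exists_eval_eq_esymPair (n * rename (Equiv.swap 0 1) d)
  have key : ∀ l : Fin 2 → ℂ, eval (esymPair l) (a * a + a * b * X 0 + b * b * X 1) =
      eval l d * eval (l ∘ Equiv.swap 0 1) d := by
    intro l
    rw [hab l, hab (l ∘ _), esymPair_comp_swap]
    simp [esymPair]
    ring
  refine ⟨α, β, a * a + a * b * X 0 + b * b * X 1, fun h0 => mul_ne_zero hx hx' ?_, fun l hl => ?_⟩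
  · rw [← key, h0, map_zero]
  · rw [key] at hl ⊢
    rw [← hαβ, map_mul, eval_rename, mul_div_mul_right _ _ (right_ne_zero_of_mul hl),
      hg l (left_ne_zero_of_mul hl)]

theorem Generically.exists_conj_diagonal {P : (Fin 2 → ℂ) → Prop} (hP : Generically P) :
    Generically fun p => ∃ (A : GL (Fin 2) ℂ) (l : Fin 2 → ℂ),
      ofEntries p = A.val * Matrix.diagonal l * A⁻¹.val ∧ P l := by
  refine ((dominant_simInv _ (hP.forall_esymPair.and generically_discr_ne_zero)).and
    generically_entry_ne_zero).mono ?_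
  rintro p ⟨⟨h1, h2⟩, h3⟩
  obtain ⟨l, hl⟩ := esymPair_surjective (simInv (ofEntries p))
  beta_reduce at h2
  rw [← hl, esymPair_discr] at h2
  obtain ⟨A, hA⟩ := _root_.exists_conj_diagonal h3
    (sub_ne_zero.1 ((pow_ne_zero_iff two_ne_zero).1 h2)) hl
  exact ⟨A, l, hA, h1 l hl⟩

/-- Some conjugate of the diagonal plane meets the open set. Its conjugating matrix is then kept
fixed while `l` varies. -/
theorem Generically.conj_diagonal {P : (Fin 2 × Fin 2 → ℂ) → Prop} (hP : Generically P) :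
    Generically fun l => ∃ A : GL (Fin 2) ℂ,
      P (entries (A.val * Matrix.diagonal l * A⁻¹.val)) := by
  obtain ⟨h, hh, hP⟩ := hP
  have hn : Generically fun p => eval p h ≠ 0 := ⟨h, hh, fun _ h => h⟩
  have ht : Generically fun _ : Fin 2 → ℂ => True := ⟨1, one_ne_zero, fun _ _ => trivial⟩
  obtain ⟨p, hp, A, l, hA, -⟩ := (hn.and ht.exists_conj_diagonal).exists
  refine (Generically.comp_of_regularAt (p := l) hP
    (T := fun l => entries (A.val * Matrix.diagonal l * A⁻¹.val))
    (fun i => .conj (.diagonal l) _ _ i.1 i.2) ?_).mono fun l hl => ⟨A, hl⟩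
  rw [← hA]
  exact hp

theorem Generically.conj_companionPair {P : (Fin 2 × Fin 2 → ℂ) → Prop} (hP : Generically P) :
    Generically fun s => ∃ A : GL (Fin 2) ℂ,
      P (entries (A.val * companionPair s * A⁻¹.val)) := by
  obtain ⟨h, hh, hP⟩ := hP
  have hn : Generically fun p => eval p h ≠ 0 := ⟨h, hh, fun _ h => h⟩
  obtain ⟨p, hp, hp1⟩ := (hn.and generically_entry_ne_zero).exists
  obtain ⟨A, hA⟩ := exists_conj_companionPair hp1
  refine (Generically.comp_of_regularAt (p := simInv (ofEntries p)) hP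
    (T := fun l => entries (A.val * companionPair l * A⁻¹.val))
    (fun i => .conj (.companionPair _) _ _ i.1 i.2) ?_).mono fun l hl => ⟨A, hl⟩
  rw [← hA]
  exact hp

theorem Generically.comp_simInv {P : (Fin 2 → ℂ) → Prop} (hP : Generically P) :
    Generically fun p => P (simInv (ofEntries p)) := dominant_simInv P hP

theorem Generically.comp_conj {P : Matrix (Fin 2) (Fin 2) ℂ → Prop}
    (hP : Generically fun p => P (ofEntries p)) (A : GL (Fin 2) ℂ) :
    Generically fun p => P (A.val * ofEntries p * A⁻¹.val) := dominant_conj A _ hP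

/-! ### Rational maps compatible with conjugation -/

theorem entries_injective : Function.Injective entries := fun M N h => by
  ext i j
  exact congrFun h (i, j)

theorem ofEntries_entries (M : Matrix (Fin 2) (Fin 2) ℂ) : ofEntries (entries M) = M := rfl

theorem isLeftInverse_iff_evalAt {Φ Φ' : MatRatMap} : RatMap.IsLeftInverse Φ' Φ ↔
    Generically fun p => ¬ Φ.Indet (ofEntries p) ∧ ¬ Φ'.Indet (Φ.evalAt (ofEntries p)) ∧
      Φ'.evalAt (Φ.evalAt (ofEntries p)) = ofEntries p :=
  ⟨fun h => Generically.mono h fun _ hp => ⟨hp.1, hp.2.1, entries_injective hp.2.2⟩,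
    fun h => Generically.mono h fun _ hp => ⟨hp.1, hp.2.1, congrArg entries hp.2.2⟩⟩

theorem generically_not_indet (Φ : MatRatMap) : Generically fun p => ¬ Φ.Indet (ofEntries p) :=
  Φ.generically_not_mem_ind

theorem conj_inv_conj (A : GL (Fin 2) ℂ) (M : Matrix (Fin 2) (Fin 2) ℂ) :
    A⁻¹.val * (A.val * M * A⁻¹.val) * A.val = M := by
  rw [mul_assoc A.val, ← mul_assoc A⁻¹.val, Units.inv_mul, one_mul, mul_assoc, Units.inv_mul,
    mul_one]

theorem eq_conj_iff {A : GL (Fin 2) ℂ} {M N : Matrix (Fin 2) (Fin 2) ℂ} :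
    A.val * M * A⁻¹.val = A.val * N * A⁻¹.val ↔ M = N :=
  ⟨fun h => by rw [← conj_inv_conj A M, h, conj_inv_conj], fun h => by rw [h]⟩

namespace MatRatMap

variable {Φ Φ' : MatRatMap} {Ψ Ψ' W W' : RatMap (Fin 2) (Fin 2)}

/-- A rational map extends a matrix-valued map at the points where the latter is regular. -/
theorem exists_of_regularAt {F : Matrix (Fin 2) (Fin 2) ℂ → Matrix (Fin 2) (Fin 2) ℂ}
    {M : Matrix (Fin 2) (Fin 2) ℂ}
    (hF : ∀ i j, RegularAt (fun q => F (ofEntries q) i j) (entries M)) :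
    ∃ Φ : MatRatMap, ∀ N, (∀ i j, RegularAt (fun q => F (ofEntries q) i j) (entries N)) →
      ¬ Φ.Indet N ∧ Φ.evalAt N = F N := by
  obtain ⟨Φ, hΦ⟩ := RatMap.exists_of_regularAt
    (T := fun q (i : Fin 2 × Fin 2) => F (ofEntries q) i.1 i.2) fun i => hF i.1 i.2
  refine ⟨Φ, fun N hN => ?_⟩
  obtain ⟨h1, h2⟩ := hΦ (entries N) fun i => hN i.1 i.2
  exact ⟨h1, entries_injective h2⟩

theorem regularAt_evalAt {M : Matrix (Fin 2) (Fin 2) ℂ} (h : ¬ Φ.Indet M) (i j : Fin 2) :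
    RegularAt (fun q => Φ.evalAt (ofEntries q) i j) (entries M) :=
  RatMap.regularAt_value (f := Φ) h (i, j)

theorem regularAt_evalAt_conj {A B M : Matrix (Fin 2) (Fin 2) ℂ} (h : ¬ Φ.Indet (A * M * B))
    (i j : Fin 2) : RegularAt (fun q => Φ.evalAt (A * ofEntries q * B) i j) (entries M) := by
  have h' : ¬ Φ.Indet (A * ofEntries (entries M) * B) := by rwa [ofEntries_entries]
  exact .evalAt (M := fun q => A * ofEntries q * B) h' (.conj (.ofEntries _) _ _) i j

/-- The indeterminacy set of a compatible map is invariant under conjugation. -/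
theorem ConjCompatible.indet_conj (hΦ : Φ.ConjCompatible) {A : GL (Fin 2) ℂ}
    {M : Matrix (Fin 2) (Fin 2) ℂ} (h : ¬ Φ.Indet (A.val * M * A⁻¹.val)) : ¬ Φ.Indet M := by
  -- This map is regular at `M` and generically equal to `Φ`, so `Φ` has no pole at `M`.
  have hreg : ∀ i : Fin 2 × Fin 2, RegularAt (fun q => entries (A⁻¹.val *
      Φ.evalAt (A.val * ofEntries q * A⁻¹.val) * A.val) i) (entries M) := fun i =>
    .conj (regularAt_evalAt_conj h) _ _ i.1 i.2
  refine (RatMap.regularAt_eq_value (f := Φ) hreg ?_).1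
  refine ((generically_not_indet Φ).and
    ((generically_not_indet Φ).comp_conj (P := fun M => ¬ Φ.Indet M) A)).mono ?_
  rintro q ⟨h1, h2⟩
  rw [← hΦ A _ h1 h2, conj_inv_conj]
  rfl

theorem ConjCompatible.evalAt_conj (hΦ : Φ.ConjCompatible) (A : GL (Fin 2) ℂ)
    {M : Matrix (Fin 2) (Fin 2) ℂ} (h : ¬ Φ.Indet M) : ¬ Φ.Indet (A.val * M * A⁻¹.val) ∧
      Φ.evalAt (A.val * M * A⁻¹.val) = A.val * Φ.evalAt M * A⁻¹.val := by
  have h2 : ¬ Φ.Indet (A.val * M * A⁻¹.val) := by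
    refine hΦ.indet_conj (A := A⁻¹) ?_
    rw [inv_inv, conj_inv_conj]
    exact h
  exact ⟨h2, (hΦ A M h h2).symm⟩

theorem ConjCompatible.generically_diagonal (hΦ : Φ.ConjCompatible) :
    Generically fun l => ¬ Φ.Indet (Matrix.diagonal l) :=
  (generically_not_indet Φ).conj_diagonal.mono fun _ ⟨_, hA⟩ => hΦ.indet_conj hA

theorem ConjCompatible.generically_companionPair (hΦ : Φ.ConjCompatible) :
    Generically fun s => ¬ Φ.Indet (companionPair s) :=
  (generically_not_indet Φ).conj_companionPair.mono fun _ ⟨_, hA⟩ => hΦ.indet_conj hA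

/-- `Φ M` commutes with every invertible matrix that commutes with `M`. -/
theorem ConjCompatible.commute (hΦ : Φ.ConjCompatible) {M : Matrix (Fin 2) (Fin 2) ℂ}
    (hM : ¬ Φ.Indet M) (A : GL (Fin 2) ℂ) (hA : A.val * M = M * A.val) :
    A.val * Φ.evalAt M = Φ.evalAt M * A.val := by
  have h1 : A.val * M * A⁻¹.val = M := by rw [hA, mul_assoc, Units.mul_inv, mul_one]
  have h2 := (hΦ.evalAt_conj A hM).2
  rw [h1] at h2
  conv_rhs => rw [h2, mul_assoc, Units.inv_mul, mul_one]

/-! ### Restriction to the diagonal plane -/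

theorem ConjCompatible.evalAt_diagonal (hΦ : Φ.ConjCompatible) {l : Fin 2 → ℂ}
    (hl : ¬ Φ.Indet (Matrix.diagonal l)) :
    Φ.evalAt (Matrix.diagonal l) =
      Matrix.diagonal fun i => Φ.evalAt (Matrix.diagonal l) i i := by
  -- `diag(1, -1)` commutes with diagonal matrices, and only with them.
  have h := hΦ.commute hl (Matrix.GeneralLinearGroup.mkOfDetNeZero (Matrix.diagonal ![1, -1])
    (by simp)) (by
      change Matrix.diagonal _ * Matrix.diagonal _ = Matrix.diagonal _ * Matrix.diagonal _
      simp only [Matrix.diagonal_mul_diagonal, mul_comm])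
  have h01 := congrFun (congrFun h 0) 1
  have h10 := congrFun (congrFun h 1) 0
  simp [Matrix.GeneralLinearGroup.mkOfDetNeZero] at h01 h10
  ext i j
  fin_cases i <;> fin_cases j <;> simp
  · linear_combination h01 / 2
  · linear_combination -h10 / 2

theorem ConjCompatible.existsUnique_isDiagRestriction (hΦ : Φ.ConjCompatible) :
    ∃! Ψ : RatMap (Fin 2) (Fin 2), Φ.IsDiagRestriction Ψ := by
  obtain ⟨l, hl⟩ := hΦ.generically_diagonal.exists
  have hreg : ∀ l, ¬ Φ.Indet (Matrix.diagonal l) → ∀ i,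
      RegularAt (fun q => Φ.evalAt (Matrix.diagonal q) i i) l :=
    fun l hl i => .evalAt hl (.diagonal l) i i
  obtain ⟨Ψ, hΨ⟩ := RatMap.exists_of_regularAt
    (T := fun q i => Φ.evalAt (Matrix.diagonal q) i i) (hreg l hl)
  refine ⟨Ψ, ⟨⟨l, hl⟩, fun l hl => ⟨(hΨ l (hreg l hl)).1, ?_⟩⟩, fun Ψ' hΨ' => ?_⟩
  · rw [(hΨ l (hreg l hl)).2, ← hΦ.evalAt_diagonal hl]
  · refine RatMap.ext_of_generically (hΦ.generically_diagonal.mono fun l hl => ?_)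
    rw [(hΨ l (hreg l hl)).2]
    funext i
    rw [(hΨ'.2 l hl).2, Matrix.diagonal_apply_eq]

/-! ### The companion slice and the skeleton -/

theorem ConjCompatible.evalAt_companionPair (hΦ : Φ.ConjCompatible) {s : Fin 2 → ℂ}
    (hs : ¬ Φ.Indet (companionPair s)) (h1 : s 1 ≠ 0) :
    Φ.evalAt (companionPair s) = Φ.evalAt (companionPair s) 0 0 • 1 +
      Φ.evalAt (companionPair s) 1 0 • companionPair s := by
  -- The companion matrix has determinant `s 1`, hence is invertible and commutes with `Φ(C_s)`. As
  -- `e₀` is cyclic, the first column of `Φ(C_s)` determines it.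
  have h := hΦ.commute hs (Matrix.GeneralLinearGroup.mkOfDetNeZero (companionPair s)
    (by simpa [companionPair, Matrix.det_fin_two_of] using h1)) rfl
  have h00 := congrFun (congrFun h 0) 0
  have h10 := congrFun (congrFun h 1) 0
  simp [Matrix.GeneralLinearGroup.mkOfDetNeZero, Matrix.mul_apply, Fin.sum_univ_two] at h00 h10
  generalize Φ.evalAt (companionPair s) = X at h00 h10 ⊢
  simp [companionPair] at h00 h10
  ext i j
  fin_cases i <;> fin_cases j <;> simp [companionPair]
  · linear_combination -h00
  · linear_combination -h10

theorem ConjCompatible.simInv_evalAt_companionPair (hΦ : Φ.ConjCompatible)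
    {M : Matrix (Fin 2) (Fin 2) ℂ} (hM : M 1 0 ≠ 0) (h : ¬ Φ.Indet (companionPair (simInv M))) :
    ¬ Φ.Indet M ∧ simInv (Φ.evalAt M) = simInv (Φ.evalAt (companionPair (simInv M))) := by
  obtain ⟨A, hA⟩ := exists_conj_companionPair hM
  obtain ⟨h1, h2⟩ := hΦ.evalAt_conj A h
  rw [← hA] at h1 h2
  exact ⟨h1, by rw [h2, simInv_conj]⟩

/-- Both sides of the skeleton identity depend only on the conjugacy class, so it descends to
companion matrices, a section of `Inv`. -/
theorem IsSkeleton.generically (hW : Φ.IsSkeleton W) (hΦ : Φ.ConjCompatible) :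
    Generically fun s => ¬ Φ.Indet (companionPair s) ∧ s ∉ W.Ind ∧
      W.value s = simInv (Φ.evalAt (companionPair s)) := by
  refine (Generically.conj_companionPair hW).mono fun s ⟨A, h1, h2, h3⟩ => ?_
  change ¬ Φ.Indet (A.val * companionPair s * A⁻¹.val) at h1
  change simInv (A.val * companionPair s * A⁻¹.val) ∉ W.Ind at h2
  change W.value (simInv (A.val * companionPair s * A⁻¹.val)) =
    simInv (Φ.evalAt (A.val * companionPair s * A⁻¹.val)) at h3
  have h4 := hΦ.indet_conj h1
  rw [simInv_conj, simInv_companionPair] at h2 h3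
  rw [(hΦ.evalAt_conj A h4).2, simInv_conj] at h3
  exact ⟨h4, h2, h3⟩

theorem ConjCompatible.existsUnique_isSkeleton (hΦ : Φ.ConjCompatible) :
    ∃! W : RatMap (Fin 2) (Fin 2), Φ.IsSkeleton W := by
  have hreg : ∀ s, ¬ Φ.Indet (companionPair s) → ∀ i,
      RegularAt (fun q => simInv (Φ.evalAt (companionPair q)) i) s :=
    fun s hs i => .simInv (.evalAt hs (.companionPair s)) i
  obtain ⟨s, hs⟩ := hΦ.generically_companionPair.exists
  obtain ⟨W, hW⟩ := RatMap.exists_of_regularAt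
    (T := fun q => simInv (Φ.evalAt (companionPair q))) (hreg s hs)
  refine ⟨W, ?_, fun W' hW' => ?_⟩
  · refine (hΦ.generically_companionPair.comp_simInv.and generically_entry_ne_zero).mono ?_
    rintro p ⟨h1, h2⟩
    obtain ⟨h3, h4⟩ := hΦ.simInv_evalAt_companionPair h2 h1
    obtain ⟨h5, h6⟩ := hW _ (hreg _ h1)
    exact ⟨h3, h5, h6.trans h4.symm⟩
  · refine RatMap.ext_of_generically ((hW'.generically hΦ).mono fun s ⟨h1, _, h3⟩ => ?_)
    rw [h3, (hW s (hreg s h1)).2]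

/-! ### Inverses -/

theorem ConjCompatible.of_isLeftInverse (hΦ : Φ.ConjCompatible)
    (h : RatMap.IsLeftInverse Φ' Φ) (h' : RatMap.IsLeftInverse Φ Φ') : Φ'.ConjCompatible := by
  intro A M hM hAM
  ext i j
  have hr1 : RegularAt (fun q => (A.val * Φ'.evalAt (ofEntries q) * A⁻¹.val) i j) (entries M) :=
    .conj (M := fun q => Φ'.evalAt (ofEntries q)) (regularAt_evalAt hM) _ _ i j
  have hr2 : RegularAt (fun q => Φ'.evalAt (A.val * ofEntries q * A⁻¹.val) i j) (entries M) :=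
    regularAt_evalAt_conj hAM i j
  suffices hg : Generically fun q => (A.val * Φ'.evalAt (ofEntries q) * A⁻¹.val) i j =
      Φ'.evalAt (A.val * ofEntries q * A⁻¹.val) i j by
    simpa only [ofEntries_entries] using hr1.eq_of_generically hr2 hg
  -- If the sides differed generically, they would differ at some `Φ(p)`, as `Φ` is dominant; but
  -- there both equal `A p A⁻¹`.
  rcases (hr1.sub hr2).generically_eq_zero_or_ne_zero with h0 | h0
  · exact h0.mono fun q hq => sub_eq_zero.1 hq
  · exfalso
    have hinv := isLeftInverse_iff_evalAt.1 h
    have h1 : Generically fun p => (A.val * Φ'.evalAt (Φ.evalAt (ofEntries p)) * A⁻¹.val) i j -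
        Φ'.evalAt (A.val * Φ.evalAt (ofEntries p) * A⁻¹.val) i j ≠ 0 := h'.dominant _ h0
    have hconj : Generically fun p => Φ'.evalAt (Φ.evalAt (A.val * ofEntries p * A⁻¹.val)) =
        A.val * ofEntries p * A⁻¹.val :=
      (hinv.mono fun _ h => h.2.2).comp_conj
        (P := fun M => Φ'.evalAt (Φ.evalAt M) = M) A
    obtain ⟨p, h1, ⟨h2, -, h4⟩, h7⟩ := (h1.and (hinv.and hconj)).exists
    rw [(hΦ.evalAt_conj A h2).2] at h7
    exact h1 (by rw [h4, h7, sub_self])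

theorem ConjCompatible.isLeftInverse_diagRestriction (hΦ : Φ.ConjCompatible)
    (hΦ' : Φ'.ConjCompatible) (hΨ : Φ.IsDiagRestriction Ψ) (hΨ' : Φ'.IsDiagRestriction Ψ')
    (h : RatMap.IsLeftInverse Φ' Φ) : RatMap.IsLeftInverse Ψ' Ψ := by
  refine (isLeftInverse_iff_evalAt.1 h).conj_diagonal.mono fun l ⟨A, h1, h2, h3⟩ => ?_
  change ¬ Φ.Indet (A.val * Matrix.diagonal l * A⁻¹.val) at h1
  change ¬ Φ'.Indet (Φ.evalAt (A.val * Matrix.diagonal l * A⁻¹.val)) at h2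
  change Φ'.evalAt (Φ.evalAt (A.val * Matrix.diagonal l * A⁻¹.val)) =
    A.val * Matrix.diagonal l * A⁻¹.val at h3
  have h4 := hΦ.indet_conj h1
  obtain ⟨h5, h6⟩ := hΨ.2 l h4
  rw [(hΦ.evalAt_conj A h4).2, h6] at h2 h3
  have h7 := hΦ'.indet_conj h2
  obtain ⟨h8, h9⟩ := hΨ'.2 _ h7
  rw [(hΦ'.evalAt_conj A h7).2, eq_conj_iff, h9] at h3
  exact ⟨h5, h8, Matrix.diagonal_injective h3⟩

theorem IsSkeleton.isLeftInverse
    (hW : Φ.IsSkeleton W) (hW' : Φ'.IsSkeleton W')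
    (h : RatMap.IsLeftInverse Φ' Φ) (h' : RatMap.IsLeftInverse Φ Φ') :
    RatMap.IsLeftInverse W' W := by
  have hWg : Generically fun p => simInv (ofEntries p) ∉ W.Ind ∧
      W.value (simInv (ofEntries p)) = simInv (Φ.evalAt (ofEntries p)) :=
    Generically.mono hW fun _ hp => hp.2
  have hWg' : Generically fun p => simInv (ofEntries p) ∉ W'.Ind ∧
      W'.value (simInv (ofEntries p)) = simInv (Φ'.evalAt (ofEntries p)) :=
    Generically.mono hW' fun _ hp => hp.2
  -- The skeleton identity of `Φ'` may be used at `Φ(p)` because `h'` makes `Φ` dominant.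
  have hdom : Generically fun p => simInv (Φ.evalAt (ofEntries p)) ∉ W'.Ind ∧
      W'.value (simInv (Φ.evalAt (ofEntries p))) =
        simInv (Φ'.evalAt (Φ.evalAt (ofEntries p))) := h'.dominant _ hWg'
  have key : Generically fun p => simInv (ofEntries p) ∉ W.Ind ∧
      W.value (simInv (ofEntries p)) ∉ W'.Ind ∧
      W'.value (W.value (simInv (ofEntries p))) = simInv (ofEntries p) := by
    refine (hWg.and (hdom.and (isLeftInverse_iff_evalAt.1 h))).mono ?_
    rintro p ⟨⟨h1, h2⟩, ⟨h3, h4⟩, h5, h6, h7⟩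
    rw [h2, h4, h7]
    exact ⟨h1, h3, rfl⟩
  refine key.conj_companionPair.mono fun s ⟨A, hA⟩ => ?_
  have : simInv (ofEntries (entries (A.val * companionPair s * A⁻¹.val))) = s :=
    (simInv_conj A _).trans (simInv_companionPair s)
  rwa [this] at hA

/-- `Φ` acts through `Ψ` on the eigenvalues of generic matrices. -/
def DiagModel (Φ : MatRatMap) (Ψ : RatMap (Fin 2) (Fin 2)) : Prop :=
  Generically fun l => ∀ A : GL (Fin 2) ℂ, ¬ Φ.Indet (A.val * Matrix.diagonal l * A⁻¹.val) ∧
    Φ.evalAt (A.val * Matrix.diagonal l * A⁻¹.val) =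
      A.val * Matrix.diagonal (Ψ.value l) * A⁻¹.val

theorem ConjCompatible.diagModel (hΦ : Φ.ConjCompatible) (hΨ : Φ.IsDiagRestriction Ψ) :
    DiagModel Φ Ψ := by
  refine hΦ.generically_diagonal.mono fun l hl A => ?_
  rw [← (hΨ.2 l hl).2]
  exact hΦ.evalAt_conj A hl

theorem DiagModel.isLeftInverse (h : DiagModel Φ Ψ) (h' : DiagModel Φ' Ψ')
    (hΨ : Dominant Ψ.value) (hinv : RatMap.IsLeftInverse Ψ' Ψ) : RatMap.IsLeftInverse Φ' Φ := by
  have hg := (Generically.and h (Generically.and (hΨ _ h') hinv)).exists_conj_diagonal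
  refine isLeftInverse_iff_evalAt.2 (hg.mono ?_)
  rintro p ⟨A, l, hp, h1, h2, -, -, h3⟩
  rw [hp, (h1 A).2, (h2 A).2, h3]
  exact ⟨(h1 A).1, (h2 A).1, rfl⟩

/-- The permutation matrix normalizes the diagonal plane and exchanges its coordinates. -/
theorem ConjCompatible.diagRestriction_comp_swap (hΦ : Φ.ConjCompatible)
    (hΨ : Φ.IsDiagRestriction Ψ) {l : Fin 2 → ℂ} (hl : ¬ Φ.Indet (Matrix.diagonal l)) :
    Ψ.value (l ∘ Equiv.swap 0 1) = Ψ.value l ∘ Equiv.swap 0 1 := by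
  obtain ⟨A, hA⟩ : ∃ A : GL (Fin 2) ℂ, ∀ x : Fin 2 → ℂ,
      A.val * Matrix.diagonal x * A⁻¹.val = Matrix.diagonal (x ∘ Equiv.swap 0 1) := by
    refine ⟨Matrix.GeneralLinearGroup.mkOfDetNeZero !![0, 1; 1, 0] (by simp), fun x => ?_⟩
    refine (conj_eq_of_mul_eq ?_).symm
    ext i j
    fin_cases i <;> fin_cases j <;>
      simp [Matrix.GeneralLinearGroup.mkOfDetNeZero, Matrix.mul_apply, Fin.sum_univ_two]
  obtain ⟨h1, h2⟩ := hΦ.evalAt_conj A hl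
  rw [hA] at h1 h2
  rw [(hΨ.2 _ h1).2, (hΨ.2 _ hl).2, hA] at h2
  exact Matrix.diagonal_injective h2

/-- The inverse of the restriction to the diagonal matrices commutes with the transposition. -/
theorem ConjCompatible.generically_inverse_comp_swap (hΦ : Φ.ConjCompatible)
    (hΨ : Φ.IsDiagRestriction Ψ) (h : RatMap.IsLeftInverse Ψ' Ψ)
    (h' : RatMap.IsLeftInverse Ψ Ψ') :
    Generically fun l => Ψ'.value (l ∘ Equiv.swap 0 1) = Ψ'.value l ∘ Equiv.swap 0 1 := by
  have hgen := Ψ'.generically_not_mem_ind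
  obtain ⟨x, hx, hx'⟩ := (hgen.and (dominant_comp_swap _ hgen)).exists
  have hreg : ∀ i, RegularAt (fun l => Ψ'.value (l ∘ Equiv.swap 0 1) i -
      Ψ'.value l (Equiv.swap 0 1 i)) x := fun i =>
    .sub (.value_comp (T := fun l => l ∘ Equiv.swap 0 1) hx' (fun j => .coord _ x) i)
      (RatMap.regularAt_value hx _)
  have key : ∀ i, Generically fun l => Ψ'.value (l ∘ Equiv.swap 0 1) i -
      Ψ'.value l (Equiv.swap 0 1 i) = 0 := by
    intro i
    -- By dominance of `Ψ` a generic failure would occur at some `Ψ(l)`, where both terms are the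
    -- `i`-th coordinate of the swapped `l`.
    refine (hreg i).generically_eq_zero_or_ne_zero.resolve_right fun h0 => ?_
    have hg : Generically fun l => l ∉ Ψ.Ind ∧ Ψ.value l ∉ Ψ'.Ind ∧ Ψ'.value (Ψ.value l) = l := h
    obtain ⟨l, h1, h2, ⟨-, -, h3⟩, -, -, h4⟩ := ((h'.dominant _ h0).and
      (hΦ.generically_diagonal.and (hg.and (dominant_comp_swap _ hg)))).exists
    apply h1
    rw [← hΦ.diagRestriction_comp_swap hΨ h2, h3, h4]
    simp
  exact (Generically.forall_finite key).mono fun l hl => funext fun i => sub_eq_zero.1 (hl i)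

/-- A symmetric rational map of the plane extends to matrices. -/
theorem exists_diagModel
    (hΨ : Generically fun l => Ψ.value (l ∘ Equiv.swap 0 1) = Ψ.value l ∘ Equiv.swap 0 1) :
    ∃ Φ : MatRatMap, DiagModel Φ Ψ := by
  obtain ⟨x, hx⟩ := Ψ.generically_not_mem_ind.exists
  obtain ⟨α, β, δ, hδ, h0⟩ := exists_eq_div_esymPair (RatMap.regularAt_value hx 0)
  let F : Matrix (Fin 2) (Fin 2) ℂ → Matrix (Fin 2) (Fin 2) ℂ := fun N =>
    Matrix.of fun i j => (eval (simInv N) α * (1 : Matrix (Fin 2) (Fin 2) ℂ) i j +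
      eval (simInv N) β * N i j) / eval (simInv N) δ
  have hF : ∀ N, F N = (eval (simInv N) δ)⁻¹ • (eval (simInv N) α • 1 + eval (simInv N) β • N) := by
    intro N
    ext i j
    simp [F, div_eq_inv_mul]
  have hFconj : ∀ (A : GL (Fin 2) ℂ) N, F (A.val * N * A⁻¹.val) = A.val * F N * A⁻¹.val := by
    intro A N
    simp only [hF, simInv_conj, mul_add, add_mul, Matrix.mul_smul, Matrix.smul_mul, mul_one,
      Units.mul_inv]
  have hreg : ∀ N, eval (simInv N) δ ≠ 0 → ∀ i j,
      RegularAt (fun q => F (ofEntries q) i j) (entries N) := by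
    intro N hN i j
    have hs := RegularAt.simInv (RegularAt.ofEntries (entries N))
    exact .div (.add (.mul (.eval_comp α hs) (.const _ _))
      (.mul (.eval_comp β hs) (.ofEntries _ _ _))) (.eval_comp δ hs) hN
  obtain ⟨s, hs⟩ := exists_eval_ne_zero hδ
  obtain ⟨Φ, hΦ⟩ := exists_of_regularAt (F := F) (hreg (companionPair s)
    (by rwa [simInv_companionPair]))
  refine ⟨Φ, (hΨ.and (dominant_esymPair _ ⟨δ, hδ, fun _ h => h⟩)).mono ?_⟩
  rintro l ⟨h1, h2⟩ A
  obtain ⟨h3, h4⟩ := hΦ (A.val * Matrix.diagonal l * A⁻¹.val)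
    (hreg _ (by rwa [simInv_conj, simInv_diagonal]))
  refine ⟨h3, h4.trans ?_⟩
  rw [hFconj]
  congr 2
  -- Symmetry reduces the second eigenvalue to the formula for component `0`, with the same `α, β,
  -- δ`.
  have h5 : Ψ.value l 1 = Ψ.value (l ∘ Equiv.swap 0 1) 0 := by
    rw [h1]
    simp
  have h6 := h0 (l ∘ Equiv.swap 0 1)
  rw [esymPair_comp_swap] at h6
  ext i j
  fin_cases i <;> fin_cases j <;> simp [F, simInv_diagonal]
  · rw [h0 l h2]
  · rw [h5, h6 h2]
    simp

theorem ConjCompatible.isBirational_iff_diagRestriction (hΦ : Φ.ConjCompatible)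
    (hΨ : Φ.IsDiagRestriction Ψ) : RatMap.IsBirational Φ ↔ RatMap.IsBirational Ψ := by
  constructor
  · rintro ⟨Φ', h, h'⟩
    have hΦ' := hΦ.of_isLeftInverse h h'
    obtain ⟨Ψ', hΨ', -⟩ := hΦ'.existsUnique_isDiagRestriction
    exact ⟨Ψ', hΦ.isLeftInverse_diagRestriction hΦ' hΨ hΨ' h,
      hΦ'.isLeftInverse_diagRestriction hΦ hΨ' hΨ h'⟩
  · rintro ⟨Ψ', h, h'⟩
    obtain ⟨Φ', hΦ'⟩ := exists_diagModel (hΦ.generically_inverse_comp_swap hΨ h h')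
    have hm := hΦ.diagModel hΨ
    exact ⟨Φ', hm.isLeftInverse hΦ' h'.dominant h, hΦ'.isLeftInverse hm h.dominant h'⟩

/-! ### Inverting a map from its skeleton -/

theorem simInv_smul_one_add_smul (a b : ℂ) (N : Matrix (Fin 2) (Fin 2) ℂ) :
    simInv (a • 1 + b • N) =
      ![2 * a + b * simInv N 0, a ^ 2 + a * b * simInv N 0 + b ^ 2 * simInv N 1] := by
  ext i
  fin_cases i <;> simp [simInv, Matrix.trace_fin_two, Matrix.det_fin_two] <;> ring

theorem simInv_eq_of_smul_one_add_smul {a b : ℂ} (hb : b ≠ 0) {M N : Matrix (Fin 2) (Fin 2) ℂ}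
    (h : simInv (a • 1 + b • M) = simInv (a • 1 + b • N)) : simInv M = simInv N := by
  rw [simInv_smul_one_add_smul, simInv_smul_one_add_smul] at h
  have h0 := congrFun h 0
  have h1 := congrFun h 1
  simp [hb] at h0
  simp [h0, hb] at h1
  ext i
  fin_cases i
  · exact h0
  · exact h1

/-- A dominant skeleton forces `Φ` to be generically of the form `a + b M` with `b ≠ 0`. -/
theorem ConjCompatible.generically_evalAt_companionPair (hΦ : Φ.ConjCompatible)
    (hW : Φ.IsSkeleton W) (hdom : Dominant W.value) : Generically fun s =>
      (¬ Φ.Indet (companionPair s) ∧ Φ.evalAt (companionPair s) 1 0 ≠ 0) ∧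
      (∀ M, M 1 0 ≠ 0 → simInv M = s → ¬ Φ.Indet M ∧
        Φ.evalAt M = Φ.evalAt (companionPair s) 0 0 • 1 + Φ.evalAt (companionPair s) 1 0 • M) ∧
      W.value s = simInv (Φ.evalAt (companionPair s)) := by
  have hs1 : Generically fun s : Fin 2 → ℂ => s 1 ≠ 0 :=
    (RegularAt.coord 1 fun _ => (1 : ℂ)).generically_ne_zero one_ne_zero
  obtain ⟨x, hx⟩ := hΦ.generically_companionPair.exists
  -- Otherwise `Φ(C_s)` would be generically scalar, and `W(s)` would have zero discriminant,
  -- against dominance.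
  have hb : Generically fun s => Φ.evalAt (companionPair s) 1 0 ≠ 0 := by
    refine (RegularAt.evalAt hx (.companionPair x) 1 0).generically_eq_zero_or_ne_zero.resolve_left
      fun h0 => ?_
    obtain ⟨s, h1, ⟨h2, -, h3⟩, h4, h5⟩ := (h0.and ((hW.generically hΦ).and
      (hs1.and (hdom _ generically_discr_ne_zero)))).exists
    apply h5
    rw [h3, hΦ.evalAt_companionPair h2 h4, simInv_smul_one_add_smul, h1]
    simp
    ring
  refine ((hW.generically hΦ).and (hs1.and hb)).mono ?_
  rintro s ⟨⟨h1, -, h2⟩, h3, h4⟩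
  refine ⟨⟨h1, h4⟩, ?_, h2⟩
  rintro M hM rfl
  obtain ⟨A, hA⟩ := exists_conj_companionPair hM
  obtain ⟨h5, h6⟩ := hΦ.evalAt_conj A h1
  rw [← hA, hΦ.evalAt_companionPair h1 h3] at h6
  rw [← hA] at h5
  refine ⟨h5, h6.trans ?_⟩
  simp only [mul_add, add_mul, Matrix.mul_smul, Matrix.smul_mul, mul_one, Units.mul_inv]
  rw [← hA]

theorem ConjCompatible.isBirational_of_skeleton (hΦ : Φ.ConjCompatible)
    (hW : Φ.IsSkeleton W) (h : RatMap.IsBirational W) : RatMap.IsBirational Φ := by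
  obtain ⟨W', h, h'⟩ := h
  have hgood := hΦ.generically_evalAt_companionPair hW h'.dominant
  let a : (Fin 2 → ℂ) → ℂ := fun s => Φ.evalAt (companionPair s) 0 0
  let b : (Fin 2 → ℂ) → ℂ := fun s => Φ.evalAt (companionPair s) 1 0
  -- The solution `M` of `N = a(s) + b(s) M`, where `s = W'(Inv N)` recovers the invariants of `M`.
  let F : Matrix (Fin 2) (Fin 2) ℂ → Matrix (Fin 2) (Fin 2) ℂ := fun N => Matrix.of fun i j =>
    (N i j - a (W'.value (simInv N)) * (1 : Matrix (Fin 2) (Fin 2) ℂ) i j) /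
      b (W'.value (simInv N))
  have hF : ∀ N, F N = (b (W'.value (simInv N)))⁻¹ • (N - a (W'.value (simInv N)) • 1) := by
    intro N
    ext i j
    simp [F, div_eq_inv_mul]
  have hreg : ∀ N, simInv N ∉ W'.Ind → ¬ Φ.Indet (companionPair (W'.value (simInv N))) →
      b (W'.value (simInv N)) ≠ 0 → ∀ i j,
      RegularAt (fun q => F (ofEntries q) i j) (entries N) := by
    intro N h1 h2 h3 i j
    have hs := RegularAt.simInv (RegularAt.ofEntries (entries N))
    have hW' : ∀ i, RegularAt (fun q => W'.value (simInv (ofEntries q)) i) (entries N) :=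
      .value_comp (T := fun q => simInv (ofEntries q)) h1 hs
    have hc : ∀ i j, RegularAt (fun q => Φ.evalAt (companionPair
        (W'.value (simInv (ofEntries q)))) i j) (entries N) :=
      .evalAt (M := fun q => companionPair (W'.value (simInv (ofEntries q)))) h2 fun i j =>
        .comp (T := fun q => W'.value (simInv (ofEntries q))) (.companionPair _ i j) hW'
    exact .div (.sub (.ofEntries _ _ _) (.mul (hc 0 0) (.const _ _))) (hc 1 0) h3
  have h'g : Generically fun s => s ∉ W'.Ind ∧ W'.value s ∉ W.Ind ∧ W.value (W'.value s) = s := h'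
  have hgood' := (h'g.and (h.dominant _ hgood))
  obtain ⟨y, ⟨hy, -, -⟩, ⟨hy1, hy2⟩, -⟩ := hgood'.exists
  obtain ⟨Φ', hΦ'⟩ := exists_of_regularAt (F := F) (hreg (companionPair y)
    (by rwa [simInv_companionPair]) (by rwa [simInv_companionPair])
    (by rwa [simInv_companionPair]))
  refine ⟨Φ', isLeftInverse_iff_evalAt.2 ?_, isLeftInverse_iff_evalAt.2 ?_⟩
  · have hg : Generically fun s => s ∉ W.Ind ∧ W.value s ∉ W'.Ind ∧ W'.value (W.value s) = s := h
    refine ((hgood.and hg).comp_simInv.and generically_entry_ne_zero).mono ?_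
    rintro p ⟨⟨⟨⟨h1, h2⟩, h3, h4⟩, h5, h6, h7⟩, h8⟩
    generalize ofEntries p = M at *
    obtain ⟨h9, h10⟩ := h3 M h8 rfl
    have h11 : simInv (Φ.evalAt M) = W.value (simInv M) := by
      rw [(hΦ.simInv_evalAt_companionPair h8 h1).2, h4]
    have h12 : W'.value (simInv (Φ.evalAt M)) = simInv M := by rw [h11, h7]
    obtain ⟨h13, h14⟩ := hΦ' (Φ.evalAt M) (hreg _ (by rwa [h11]) (by rwa [h12]) (by rwa [h12]))
    refine ⟨h9, h13, ?_⟩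
    rw [h14, hF, h12, h10, add_sub_cancel_left, smul_smul, inv_mul_cancel₀ h2, one_smul]
  · refine (hgood'.comp_simInv.and generically_entry_ne_zero).mono ?_
    rintro p ⟨⟨⟨h1, h2, h3⟩, ⟨h4, h5⟩, h6, h7⟩, h8⟩
    generalize ofEntries p = N at *
    obtain ⟨h9, h10⟩ := hΦ' N (hreg _ h1 h4 h5)
    have h11 : (F N) 1 0 ≠ 0 := by
      simpa [F] using ⟨h8, h5⟩
    have hN : a (W'.value (simInv N)) • 1 + b (W'.value (simInv N)) • F N = N := by
      rw [hF, smul_smul, mul_inv_cancel₀ h5, one_smul, add_sub_cancel]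
    -- With `s = W'(Inv N)`, `N = a + b F(N)` has the invariants `W(s)` of `Φ(C_s) = a + b C_s`; as
    -- `b ≠ 0`, `F(N)` and `C_s` have equal invariants.
    have h12 : simInv (F N) = W'.value (simInv N) := by
      have hC := (h6 (companionPair (W'.value (simInv N))) (by simp [companionPair])
        (simInv_companionPair _)).2
      have h12 := (congrArg simInv hN).trans ((h3.symm.trans h7).trans (congrArg simInv hC))
      exact (simInv_eq_of_smul_one_add_smul h5 h12).trans (simInv_companionPair _)
    obtain ⟨h13, h14⟩ := h6 (F N) h11 h12
    rw [h10]
    exact ⟨h9, h13, h14.trans hN⟩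

theorem ConjCompatible.isBirational_iff_skeleton (hΦ : Φ.ConjCompatible)
    (hW : Φ.IsSkeleton W) : RatMap.IsBirational Φ ↔ RatMap.IsBirational W := by
  refine ⟨?_, hΦ.isBirational_of_skeleton hW⟩
  rintro ⟨Φ', h, h'⟩
  have hΦ' := hΦ.of_isLeftInverse h h'
  obtain ⟨W', hW', -⟩ := hΦ'.existsUnique_isSkeleton
  exact ⟨W', hW.isLeftInverse hW' h h', hW'.isLeftInverse hW h' h⟩

end MatRatMap

end

theorem mainTheorem6 (Φ : MatRatMap) (hΦ : Φ.ConjCompatible) :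
    (∃! Ψ : RatMap (Fin 2) (Fin 2), Φ.IsDiagRestriction Ψ) ∧
    (∀ Ψ : RatMap (Fin 2) (Fin 2), Φ.IsDiagRestriction Ψ →
      (RatMap.IsBirational Φ ↔ RatMap.IsBirational Ψ)) ∧
    (∃! W : RatMap (Fin 2) (Fin 2), Φ.IsSkeleton W) ∧
    (∀ W : RatMap (Fin 2) (Fin 2), Φ.IsSkeleton W →
      (RatMap.IsBirational Φ ↔ RatMap.IsBirational W)) :=
  ⟨hΦ.existsUnique_isDiagRestriction, fun _ hΨ => hΦ.isBirational_iff_diagRestriction hΨ,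
    hΦ.existsUnique_isSkeleton, fun _ hW => hΦ.isBirational_iff_skeleton hW⟩
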